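/- Let $N\ge 1$ and $m\ge 1$ be integers and let $\rho_2,\dots,\rho_N$ be real numbers with $|\rho_n|<1$. Let $x_{n,k},y_{n,k}$ ($1\le n\le N$, $1\le k\le m$) be jointly independent Gaussian random variables with mean $0$ and variance $1/2$. Put $g_{1,k}=x_{1,k}+\jmath y_{1,k}$ and, for $2\le n\le N$, $$g_{n,k}=\sqrt{1-\rho_n^2}\,x_{n,k}+\rho_n x_{1,k}+\jmath\left(\sqrt{1-\rho_n^2}\,y_{n,k}+\rho_n y_{1,k}\right),$$ where $\jmath=\sqrt{-1}$, and let $\hat h_n=\sum_{k=1}^m|g_{n,k}|^2$ for $1\le n\le N$ and $\hat h=\max\{\hat h_1,\dots,\hat h_N\}$. Write $\gamma(a,b)=\int_0^b e^{-t}t^{a-1}\,dt$ for the lower incomplete gamma function and $$S=1+\sum_{n=2}^N\frac{\rho_n^2}{1-\rho_n^2}.$$ Then for every $x\ge 0$ the cumulative distribution function of $\hat h$ is given by the convergent series $$F_{\hat h}(x)=\frac{1}{\Gamma(m)}\sum_{k=0}^\infty\frac{c_k}{S^{m+k}}\,\gamma(m+k,Sx),$$ where $$c_k=\sum_{\substack{l_2,\dots,l_N\ge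 0\\ l_2+\cdots+l_N=k}}\alpha_{2,l_2}\alpha_{3,l_3}\cdots\alpha_{N,l_N},\qquad \alpha_{n,l}=\left(\frac{\rho_n^2}{1-\rho_n^2}\right)^{l}\frac{\gamma\left(m+l,\frac{x}{1-\rho_n^2}\right)}{l!\,\Gamma(m+l)}$$ (with $0^0=1$; for $N=1$ this means $c_0=1$ and $c_k=0$ for $k>0$). If moreover $\rho_n=0$ for all $n$, then $S=1$, $c_k=0$ for all $k>0$, and $$F_{\hat h}(x)=\left(\frac{\gamma(m,x)}{\Gamma(m)}\right)^N.$$ -/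

import Mathlib

open MeasureTheory ProbabilityTheory

noncomputable section

namespace FluidAntenna

/-- The lower incomplete gamma function `γ(a, x) = ∫₀ˣ exp (-t) t ^ (a - 1) dt`. -/
def lowerGamma (a x : ℝ) : ℝ := ∫ t in (0 : ℝ)..x, Real.exp (-t) * t ^ (a - 1)

section Model

variable {Ω : Type*} {M m : ℕ}

/-- The complex Gaussian components `g n k` of the channels at the `N = M + 1` ports, with unit
`σ`. Port `0` is the reference port; the other ports are `n.succ` for `n : Fin M`, and `ρ n`
is the correlation parameter of the port `n.succ` with respect to the reference port. -/
def gain (ρ : Fin M → ℝ) (X Y : Fin (M + 1) → Fin m → Ω → ℝ)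
    (n : Fin (M + 1)) (k : Fin m) (ω : Ω) : ℂ :=
  Fin.cases (motive := fun _ => ℂ)
    ((X 0 k ω : ℂ) + Complex.I * (Y 0 k ω : ℂ))
    (fun j =>
      ((Real.sqrt (1 - ρ j ^ 2) * X j.succ k ω + ρ j * X 0 k ω : ℝ) : ℂ) +
        Complex.I * ((Real.sqrt (1 - ρ j ^ 2) * Y j.succ k ω + ρ j * Y 0 k ω : ℝ) : ℂ))
    n

/-- The channel power at port `n`: the sum of the squared magnitudes of its components. -/
def channel (ρ : Fin M → ℝ) (X Y : Fin (M + 1) → Fin m → Ω → ℝ)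
    (n : Fin (M + 1)) (ω : Ω) : ℝ :=
  ∑ k : Fin m, ‖gain ρ X Y n k ω‖ ^ 2

/-- The largest of the `M + 1` channel powers. -/
def maxChannel (ρ : Fin M → ℝ) (X Y : Fin (M + 1) → Fin m → Ω → ℝ) (ω : Ω) : ℝ :=
  Finset.univ.sup' Finset.univ_nonempty (fun n : Fin (M + 1) => channel ρ X Y n ω)

end Model

/-- `S = 1 + ∑ ρₙ² / (1 - ρₙ²)`, the sum being over the ports other than the reference port. -/
def S {M : ℕ} (ρ : Fin M → ℝ) : ℝ := 1 + ∑ n : Fin M, ρ n ^ 2 / (1 - ρ n ^ 2)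

/-- `α = (r² / (1 - r²)) ^ l * γ(m + l, x / (1 - r²)) / (l! Γ(m + l))`. -/
def alpha (m : ℕ) (r x : ℝ) (l : ℕ) : ℝ :=
  (r ^ 2 / (1 - r ^ 2)) ^ l *
    (lowerGamma (m + l) (x / (1 - r ^ 2)) / (l.factorial * Real.Gamma (m + l)))

/-- The sum of `∏ₙ α_{n, lₙ}` over all `l : Fin M → ℕ` with `∑ₙ lₙ = k`. -/
def coeff {M : ℕ} (m : ℕ) (ρ : Fin M → ℝ) (x : ℝ) (k : ℕ) : ℝ :=
  ∑ l ∈ Finset.piAntidiag (Finset.univ : Finset (Fin M)) k,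
    ∏ n : Fin M, alpha m (ρ n) x (l n)

end FluidAntenna

end

/-!
Condition on the reference port. If its power is `u`, then the other powers are independent, and
the power of a port with parameter `r` is a sum of squares of `2 m` Gaussians of variance
`(1 - r²) / 2` whose means have squares adding up to `r² u`. Its law depends on these means only
through `r² u`: comparing moment generating functions near `0`, it is the mixture of the gamma laws
of shapes `m + l` and rate `1 / (1 - r²)` with Poisson weights of mean `r² u / (1 - r²)`. Its
distribution function at `x` is therefore `exp (-r² u / (1 - r²)) * ∑ l, α_l * u ^ l`.

Over all the ports the exponential factors multiply to `exp (-(S - 1) u)` and the power series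
multiply to `∑ k, c_k * u ^ k` by the Cauchy product. The law of `u` is the gamma law of shape `m`
and rate `1`, on which `exp (-(S - 1) u)` raises the rate to `S`; integrating `u ^ k` over `u ≤ x`
then gives the `k`-th term of the series.
-/

namespace FluidAntenna

open scoped ENNReal Topology

theorem ext_of_mgf_eventuallyEq {μ ν : Measure ℝ} [IsFiniteMeasure μ] [IsFiniteMeasure ν]
    (hν : 0 ∈ interior (integrableExpSet id ν)) (h : mgf id μ =ᶠ[𝓝 0] mgf id ν) : μ = ν := by
  have hmass : μ Set.univ = ν Set.univ := by
    simpa [measureReal_def, ENNReal.toReal_eq_toReal_iff'] using h.self_of_nhds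
  rcases eq_zero_or_neZero ν with rfl | _
  · simpa using hmass
  have : NeZero μ := ⟨fun hμ => by simp [hμ, NeZero.ne'] at hmass⟩
  have hμ : 0 ∈ interior (integrableExpSet id μ) := by
    rw [mem_interior_iff_mem_nhds] at hν ⊢
    filter_upwards [h, hν] with t ht hνt
    exact mgf_pos_iff.mp (ht ▸ mgf_pos_iff.mpr hνt)
  set U := interior (integrableExpSet id μ) ∩ interior (integrableExpSet id ν)
  have hU : IsPreconnected {z : ℂ | z.re ∈ U} :=
    ((convex_integrableExpSet.interior.inter convex_integrableExpSet.interior).linear_preimage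
      Complex.reLm).isPreconnected
  have hreal : ∃ᶠ z in 𝓝[≠] (0 : ℂ), complexMGF id μ z = complexMGF id ν z := by
    have hcast : Filter.Tendsto ((↑) : ℝ → ℂ) (𝓝[≠] 0) (𝓝[≠] 0) :=
      Complex.continuous_ofReal.continuousWithinAt.tendsto_nhdsWithin fun t ht => by simpa using ht
    refine hcast.frequently (Filter.Eventually.frequently ?_)
    filter_upwards [h.filter_mono nhdsWithin_le_nhds] with t ht
    rw [complexMGF_ofReal, complexMGF_ofReal, ht]
  have hstrip : Set.EqOn (complexMGF id μ) (complexMGF id ν) {z | z.re ∈ U} :=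
    (analyticOnNhd_complexMGF.mono fun _ hz => hz.1).eqOn_of_preconnected_of_frequently_eq
      (analyticOnNhd_complexMGF.mono fun _ hz => hz.2) hU (z₀ := 0) (by exact ⟨hμ, hν⟩) hreal
  refine Measure.ext_of_charFun (funext fun t => ?_)
  rw [← complexMGF_id_mul_I, ← complexMGF_id_mul_I]
  exact hstrip (by simpa using ⟨hμ, hν⟩)

theorem lowerGamma_nonneg (a : ℝ) {x : ℝ} (hx : 0 ≤ x) : 0 ≤ lowerGamma a x :=
  intervalIntegral.integral_nonneg hx fun t ht => by
    have := ht.1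
    positivity

theorem gammaMeasure_Iic {a r x : ℝ} (ha : 0 < a) (hr : 0 < r) (hx : 0 ≤ x) :
    gammaMeasure a r (Set.Iic x) = ENNReal.ofReal (lowerGamma a (r * x) / Real.Gamma a) := by
  have : IsProbabilityMeasure (gammaMeasure a r) := isProbabilityMeasure_gammaMeasure ha hr
  have hpdf : ∫ t in Set.Iic x, gammaPDFReal a r t = ∫ t in (0 : ℝ)..x,
      r / Real.Gamma a * (Real.exp (-(r * t)) * (r * t) ^ (a - 1)) := by
    rw [intervalIntegral.integral_of_le hx, ← integral_Icc_eq_integral_Ioc,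
      setIntegral_eq_of_subset_of_forall_sdiff_eq_zero measurableSet_Iic
        (Set.Icc_subset_Iic_self : Set.Icc 0 x ⊆ _) fun t ht => ?_]
    · refine setIntegral_congr_fun measurableSet_Icc fun t ht => ?_
      simp only [gammaPDFReal, if_pos ht.1, Real.mul_rpow hr.le ht.1, Real.rpow_sub_one hr.ne']
      field_simp
    · exact if_neg fun h => ht.2 ⟨h, ht.1⟩
  rw [← ofReal_cdf, cdf_gammaMeasure_eq_integral ha hr, hpdf, intervalIntegral.integral_const_mul,
    intervalIntegral.integral_comp_mul_left (fun t => Real.exp (-t) * t ^ (a - 1)) hr.ne',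
    mul_zero, lowerGamma, smul_eq_mul]
  congr 1
  field_simp

theorem withDensity_pow_mul_exp_gammaMeasure {a r b : ℝ} (ha : 0 < a) (hr : 0 < r)
    (hb : 0 < r + b) (k : ℕ) :
    (gammaMeasure a r).withDensity (fun u => ENNReal.ofReal (u ^ k * Real.exp (-(b * u)))) =
      ENNReal.ofReal (r ^ a * Real.Gamma (a + k) / (Real.Gamma a * (r + b) ^ (a + k))) •
        gammaMeasure (a + k) (r + b) := by
  rw [gammaMeasure, gammaMeasure, ← withDensity_mul _ (by unfold gammaPDF; fun_prop) (by fun_prop),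
    ← withDensity_smul _ (by unfold gammaPDF; fun_prop)]
  refine withDensity_congr_ae ?_
  filter_upwards [compl_mem_ae_iff.mpr (measure_singleton (0 : ℝ))] with u hu
  rcases lt_or_gt_of_ne hu with hu | hu
  · simp [gammaPDF_of_neg hu]
  · have hpow : u ^ (a + k - 1) = u ^ (a - 1) * u ^ k := by
      rw [add_sub_right_comm, Real.rpow_add_natCast hu.ne']
    have hexp : Real.exp (-((r + b) * u)) = Real.exp (-(r * u)) * Real.exp (-(b * u)) := by
      rw [← Real.exp_add]; ring_nf
    simp only [Pi.mul_apply, Pi.smul_apply, smul_eq_mul, gammaPDF_of_nonneg hu.le]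
    rw [← ENNReal.ofReal_mul (by positivity), ← ENNReal.ofReal_mul (by positivity), hpow, hexp]
    congr 1
    field_simp

theorem lintegral_exp_mul_gammaMeasure {a r t : ℝ} (ha : 0 < a) (hr : 0 < r) (ht : t < r) :
    ∫⁻ u, ENNReal.ofReal (Real.exp (t * u)) ∂gammaMeasure a r =
      ENNReal.ofReal ((r / (r - t)) ^ a) := by
  have hrt : 0 < r - t := sub_pos.mpr ht
  have := isProbabilityMeasure_gammaMeasure ha hrt
  have htilt := congrArg (· Set.univ)
    (withDensity_pow_mul_exp_gammaMeasure ha hr (b := -t) (by simpa [← sub_eq_add_neg]) 0)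
  have hΓ := (Real.Gamma_pos_of_pos ha).ne'
  simpa [← sub_eq_add_neg, Real.div_rpow hr.le hrt.le, mul_comm (Real.Gamma a),
    mul_div_mul_right _ _ hΓ] using htilt

/-- The noncentral gamma distribution with shape `a`, rate `r` and noncentrality `c`: the mixture,
with Poisson weights of mean `c`, of the gamma distributions of shapes `a, a + 1, …` and rate `r`.
It is the law of a sum of squares of independent Gaussian variables. -/
noncomputable def noncentralGamma (a r c : ℝ) : Measure ℝ :=
  Measure.sum fun l : ℕ =>
    ENNReal.ofReal (Real.exp (-c) * (c ^ l / l.factorial)) • gammaMeasure (a + l) r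

theorem noncentralGamma_zero (a r : ℝ) : noncentralGamma a r 0 = gammaMeasure a r := by
  ext s hs
  rw [noncentralGamma, Measure.sum_apply _ hs, tsum_eq_single 0 fun l hl => by simp [hl]]
  simp

section NoncentralGamma

variable {a r c : ℝ}

theorem lintegral_exp_mul_noncentralGamma (ha : 0 < a) (hr : 0 < r) (hc : 0 ≤ c) {t : ℝ}
    (ht : t < r) :
    ∫⁻ u, ENNReal.ofReal (Real.exp (t * u)) ∂noncentralGamma a r c =
      ENNReal.ofReal ((r / (r - t)) ^ a * Real.exp (c * t / (r - t))) := by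
  have hrt : 0 < r - t := sub_pos.mpr ht
  have hsum : HasSum (fun l : ℕ => Real.exp (-c) * (c ^ l / l.factorial) * (r / (r - t)) ^ (a + l))
      ((r / (r - t)) ^ a * Real.exp (c * t / (r - t))) := by
    have hexp := (NormedSpace.expSeries_div_hasSum_exp (c * (r / (r - t)))).mul_left
      ((r / (r - t)) ^ a * Real.exp (-c))
    rw [← Real.exp_eq_exp_ℝ, mul_assoc, ← Real.exp_add] at hexp
    have hexponent : -c + c * (r / (r - t)) = c * t / (r - t) := by
      field_simp
      ring
    rw [hexponent] at hexp
    refine hexp.congr_fun fun l => ?_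
    rw [Real.rpow_add_natCast (by positivity), mul_pow]
    ring
  rw [noncentralGamma, lintegral_sum_measure, ← hsum.tsum_eq,
    ENNReal.ofReal_tsum_of_nonneg (fun l => by positivity) hsum.summable]
  refine tsum_congr fun l => ?_
  rw [lintegral_smul_measure, lintegral_exp_mul_gammaMeasure (by positivity) hr ht, smul_eq_mul,
    ← ENNReal.ofReal_mul (by positivity)]

theorem isProbabilityMeasure_noncentralGamma (ha : 0 < a) (hr : 0 < r) (hc : 0 ≤ c) :
    IsProbabilityMeasure (noncentralGamma a r c) where
  measure_univ := by simpa [hr.ne'] using lintegral_exp_mul_noncentralGamma ha hr hc hr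

theorem mgf_noncentralGamma (ha : 0 < a) (hr : 0 < r) (hc : 0 ≤ c) {t : ℝ} (ht : t < r) :
    mgf id (noncentralGamma a r c) t = (r / (r - t)) ^ a * Real.exp (c * t / (r - t)) := by
  rw [mgf, integral_eq_lintegral_of_nonneg_ae (ae_of_all _ fun u => Real.exp_nonneg _)
    (by fun_prop)]
  simp only [id_eq]
  rw [lintegral_exp_mul_noncentralGamma ha hr hc ht, ENNReal.toReal_ofReal (by positivity)]

theorem noncentralGamma_Iic (ha : 0 < a) (hr : 0 < r) (hc : 0 ≤ c) {x : ℝ} (hx : 0 ≤ x) :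
    noncentralGamma a r c (Set.Iic x) = ∑' l : ℕ, ENNReal.ofReal (Real.exp (-c) *
      (c ^ l / l.factorial) * (lowerGamma (a + l) (r * x) / Real.Gamma (a + l))) := by
  rw [noncentralGamma, Measure.sum_apply _ measurableSet_Iic]
  refine tsum_congr fun l => ?_
  rw [Measure.smul_apply, gammaMeasure_Iic (by positivity) hr hx, smul_eq_mul,
    ← ENNReal.ofReal_mul (by positivity)]

end NoncentralGamma

theorem mgf_sq_gaussianReal (μ : ℝ) {v : NNReal} (hv : v ≠ 0) {t : ℝ} (ht : 2 * v * t < 1) :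
    mgf (· ^ 2) (gaussianReal μ v) t =
      (1 / (1 - 2 * v * t)) ^ (1 / 2 : ℝ) * Real.exp (μ ^ 2 * t / (1 - 2 * v * t)) := by
  set d : ℝ := 1 - 2 * v * t with hd
  have hd0 : 0 < d := sub_pos.mpr ht
  have hv' : v / d.toNNReal ≠ 0 := div_ne_zero hv (by simpa using hd0)
  -- completing the square
  have htilt (z : ℝ) : gaussianPDFReal μ v z * Real.exp (t * z ^ 2) =
      (1 / d) ^ (1 / 2 : ℝ) * Real.exp (μ ^ 2 * t / d) *
        gaussianPDFReal (μ / d) (v / d.toNNReal) z := by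
    have hsqrt : (√(2 * Real.pi * v))⁻¹ = (1 / d) ^ (1 / 2 : ℝ) * (√(2 * Real.pi * (v / d)))⁻¹ := by
      rw [← Real.sqrt_eq_rpow, ← Real.sqrt_inv, ← Real.sqrt_inv, ← Real.sqrt_mul (by positivity)]
      congr 1
      field_simp
    have hexp : -(z - μ) ^ 2 / (2 * v) + t * z ^ 2 =
        μ ^ 2 * t / d + -(z - μ / d) ^ 2 / (2 * (v / d)) := by
      field_simp
      rw [hd]
      ring
    simp only [gaussianPDFReal, NNReal.coe_div, Real.coe_toNNReal _ hd0.le, hsqrt]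
    rw [mul_assoc, ← Real.exp_add, hexp, Real.exp_add]
    ring
  simp only [mgf, integral_gaussianReal_eq_integral_smul hv, smul_eq_mul, htilt]
  rw [integral_const_mul, integral_gaussianPDFReal_eq_one _ hv', mul_one]

theorem mgf_sum_sq_pi_gaussianReal {ι : Type*} [Fintype ι] (μ : ι → ℝ) {v : NNReal}
    (hv : v ≠ 0) {t : ℝ} (ht : 2 * v * t < 1) :
    mgf (fun z => ∑ i, z i ^ 2) (Measure.pi fun i => gaussianReal (μ i) v) t =
      (1 / (1 - 2 * v * t)) ^ (Fintype.card ι / 2 : ℝ) *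
        Real.exp ((∑ i, μ i ^ 2) * t / (1 - 2 * v * t)) := by
  have hindep : iIndepFun (fun i (z : ι → ℝ) => z i ^ 2)
      (Measure.pi fun i => gaussianReal (μ i) v) :=
    iIndepFun_pi (X := fun _ x => x ^ 2) fun i => by fun_prop
  have hcoord (i : ι) : mgf (fun z : ι → ℝ => z i ^ 2) (Measure.pi fun i => gaussianReal (μ i) v) t
      = mgf (· ^ 2) (gaussianReal (μ i) v) t := by
    have heval := measurePreserving_eval (fun i => gaussianReal (μ i) v) i
    rw [← heval.map_eq, mgf_map heval.aemeasurable (by fun_prop)]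
    rfl
  have hmgf := hindep.mgf_sum (t := t) (fun i => by fun_prop) Finset.univ
  simp only [hcoord, mgf_sq_gaussianReal _ hv ht, Finset.prod_mul_distrib, Finset.prod_const,
    ← Real.exp_sum, ← Finset.sum_div, ← Finset.sum_mul, Finset.card_univ] at hmgf
  rw [← Real.rpow_mul_natCast (one_div_nonneg.mpr (sub_pos.mpr ht).le), one_div_mul_eq_div] at hmgf
  have hfun : (fun z : ι → ℝ => ∑ i, z i ^ 2) = ∑ i, fun z => z i ^ 2 := by
    ext z
    rw [Finset.sum_apply]
  rw [hfun, hmgf]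

theorem map_sum_sq_pi_gaussianReal {ι : Type*} [Fintype ι] [Nonempty ι] (μ : ι → ℝ) {v : NNReal}
    (hv : v ≠ 0) :
    (Measure.pi fun i => gaussianReal (μ i) v).map (fun z => ∑ i, z i ^ 2) =
      noncentralGamma (Fintype.card ι / 2) (1 / (2 * v)) ((∑ i, μ i ^ 2) / (2 * v)) := by
  have ha : (0 : ℝ) < Fintype.card ι / 2 := by positivity
  have hr : (0 : ℝ) < 1 / (2 * v) := by positivity
  have hc : 0 ≤ (∑ i, μ i ^ 2) / (2 * v) := by positivity
  have := isProbabilityMeasure_noncentralGamma ha hr hc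
  have hsum : Measurable fun z : ι → ℝ => ∑ i, z i ^ 2 := by fun_prop
  have := Measure.isProbabilityMeasure_map (μ := Measure.pi fun i => gaussianReal (μ i) v)
    hsum.aemeasurable
  have hnhds : ∀ᶠ t : ℝ in 𝓝 0, t < 1 / (2 * v) := Iio_mem_nhds hr
  refine ext_of_mgf_eventuallyEq ?_ ?_
  · rw [mem_interior_iff_mem_nhds]
    filter_upwards [hnhds] with t ht
    refine mgf_pos_iff.mp ?_
    have : 0 < 1 / (2 * v) - t := sub_pos.mpr ht
    rw [mgf_noncentralGamma ha hr hc ht]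
    positivity
  · filter_upwards [hnhds] with t ht
    have ht' : 2 * v * t < 1 := by rwa [lt_div_iff₀' (by positivity)] at ht
    have hd : 1 / (2 * v) - t = (1 - 2 * v * t) / (2 * v) := by field_simp
    rw [mgf_id_map hsum.aemeasurable, mgf_sum_sq_pi_gaussianReal μ hv ht',
      mgf_noncentralGamma ha hr hc ht, hd]
    congr 2 <;> field_simp

theorem map_sum_sq_affine_pi_gaussianReal {ι : Type*} [Fintype ι] [Nonempty ι] {s : ℝ}
    (hs : s ≠ 0) (μ : ι → ℝ) {v : NNReal} (hv : v ≠ 0) :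
    (Measure.pi fun _ => gaussianReal 0 v).map (fun w => ∑ i, (s * w i + μ i) ^ 2) =
      noncentralGamma (Fintype.card ι / 2) (1 / (2 * (s ^ 2 * v)))
        ((∑ i, μ i ^ 2) / (2 * (s ^ 2 * v))) := by
  have hlaw (i : ι) : (gaussianReal 0 v).map (fun w => s * w + μ i) =
      gaussianReal (μ i) (Real.nnabs s ^ 2 * v) := by
    have hcomp : (fun w => s * w + μ i) = (· + μ i) ∘ (s * ·) := rfl
    rw [hcomp, ← Measure.map_map (by fun_prop) (by fun_prop), gaussianReal_map_const_mul,
      gaussianReal_map_add_const, mul_zero, zero_add]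
    congr 2
    ext
    simp
  have hpi := Measure.pi_map_pi (μ := fun _ : ι => gaussianReal 0 v)
    (f := fun i w => s * w + μ i) fun i => by fun_prop
  have hsum := map_sum_sq_pi_gaussianReal μ (v := Real.nnabs s ^ 2 * v) (by simp [hs, hv])
  simp only [← hlaw] at hsum
  rw [← hpi, Measure.map_map (by fun_prop) (by fun_prop)] at hsum
  simpa [Function.comp_def] using hsum

theorem setLIntegral_Iic_pow_mul_exp_gammaMeasure {a r b x : ℝ} (ha : 0 < a) (hr : 0 < r)
    (hb : 0 < r + b) (hx : 0 ≤ x) (k : ℕ) :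
    ∫⁻ u in Set.Iic x, ENNReal.ofReal (u ^ k * Real.exp (-(b * u))) ∂gammaMeasure a r =
      ENNReal.ofReal
        (r ^ a / Real.Gamma a * (lowerGamma (a + k) ((r + b) * x) / (r + b) ^ (a + k))) := by
  rw [← withDensity_apply _ measurableSet_Iic, withDensity_pow_mul_exp_gammaMeasure ha hr hb,
    Measure.smul_apply, gammaMeasure_Iic (by positivity) hb hx, smul_eq_mul,
    ← ENNReal.ofReal_mul (by positivity)]
  congr 1
  field_simp

theorem setLIntegral_Iic_exp_mul_tsum_gammaMeasure {a r b x : ℝ} (ha : 0 < a) (hr : 0 < r)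
    (hb : 0 < r + b) (hx : 0 ≤ x) {c : ℕ → ℝ} (hc : ∀ k, 0 ≤ c k) :
    ∫⁻ u in Set.Iic x, ENNReal.ofReal (Real.exp (-(b * u))) *
        ∑' k : ℕ, ENNReal.ofReal (c k * u ^ k) ∂gammaMeasure a r =
      ∑' k : ℕ, ENNReal.ofReal (r ^ a / Real.Gamma a *
        (c k / (r + b) ^ (a + k) * lowerGamma (a + k) ((r + b) * x))) := by
  have hterm (k : ℕ) (u : ℝ) :
      ENNReal.ofReal (Real.exp (-(b * u))) * ENNReal.ofReal (c k * u ^ k) =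
        ENNReal.ofReal (c k) * ENNReal.ofReal (u ^ k * Real.exp (-(b * u))) := by
    rw [← ENNReal.ofReal_mul (Real.exp_nonneg _), ← ENNReal.ofReal_mul (hc k)]
    ring_nf
  simp only [← ENNReal.tsum_mul_left, hterm]
  rw [lintegral_tsum fun k => by fun_prop]
  refine tsum_congr fun k => ?_
  rw [lintegral_const_mul _ (by fun_prop),
    setLIntegral_Iic_pow_mul_exp_gammaMeasure ha hr hb hx, ← ENNReal.ofReal_mul (hc k)]
  ring_nf

theorem ennreal_tsum_mul_tsum_eq_tsum_sum_antidiagonal (f g : ℕ → ℝ≥0∞) :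
    (∑' a, f a) * ∑' b, g b = ∑' n, ∑ p ∈ Finset.HasAntidiagonal.antidiagonal n, f p.1 * g p.2 := by
  simp_rw [← ENNReal.tsum_mul_right, ← ENNReal.tsum_mul_left]
  rw [← ENNReal.tsum_prod, ← Finset.HasAntidiagonal.sigmaAntidiagonalEquivProd.tsum_eq,
    ENNReal.tsum_sigma']
  refine tsum_congr fun n => ?_
  rw [tsum_fintype]
  exact Finset.sum_coe_sort _ fun p : ℕ × ℕ => f p.1 * g p.2

theorem ennreal_prod_tsum_eq_tsum_sum_piAntidiag {ι : Type*} [DecidableEq ι] (s : Finset ι)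
    (f : ι → ℕ → ℝ≥0∞) :
    ∏ i ∈ s, ∑' l, f i l = ∑' k, ∑ l ∈ s.piAntidiag k, ∏ i ∈ s, f i (l i) := by
  induction s using Finset.cons_induction with
  | empty =>
    rw [tsum_eq_single 0 fun k hk => by simp [Finset.piAntidiag_empty_of_ne_zero hk]]
    simp
  | cons i s hi ih =>
    rw [Finset.prod_cons, ih, ennreal_tsum_mul_tsum_eq_tsum_sum_antidiagonal]
    refine tsum_congr fun n => ?_
    rw [Finset.piAntidiag_cons, Finset.sum_disjiUnion]
    refine Finset.sum_congr rfl fun p _ => ?_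
    rw [Finset.sum_map, Finset.mul_sum]
    refine Finset.sum_congr rfl fun l hl => ?_
    have hli : l i = 0 := by
      by_contra h
      exact hi ((Finset.mem_piAntidiag.mp hl).2 i h)
    have hlj : ∀ j ∈ s, l j + (if j = i then p.1 else 0) = l j := fun j hj => by
      simp [ne_of_mem_of_not_mem hj hi]
    rw [Finset.prod_cons]
    simp +contextual [hli, hlj]

section Coefficients

variable {M m : ℕ} {r x u : ℝ} {ρ : Fin M → ℝ}

theorem one_sub_sq_pos (hr : |r| < 1) : 0 < 1 - r ^ 2 :=
  sub_pos.mpr ((sq_lt_one_iff_abs_lt_one r).mpr hr)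

theorem alpha_nonneg (hr : |r| < 1) (hx : 0 ≤ x) (l : ℕ) : 0 ≤ alpha m r x l := by
  have hr' := one_sub_sq_pos hr
  have hγ := lowerGamma_nonneg (m + l) (div_nonneg hx hr'.le)
  unfold alpha
  positivity

theorem coeff_nonneg (hρ : ∀ n, |ρ n| < 1) (hx : 0 ≤ x) (k : ℕ) :
    0 ≤ coeff m ρ x k :=
  Finset.sum_nonneg fun _ _ => Finset.prod_nonneg fun n _ => alpha_nonneg (hρ n) hx _

theorem S_pos (hρ : ∀ n, |ρ n| < 1) : 0 < S ρ :=
  add_pos_of_pos_of_nonneg one_pos <|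
    Finset.sum_nonneg fun n _ => div_nonneg (sq_nonneg _) (one_sub_sq_pos (hρ n)).le

theorem prod_tsum_alpha (hρ : ∀ n, |ρ n| < 1) (hx : 0 ≤ x) (hu : 0 ≤ u) :
    ∏ n, ∑' l : ℕ, ENNReal.ofReal (alpha m (ρ n) x l * u ^ l) =
      ∑' k : ℕ, ENNReal.ofReal (coeff m ρ x k * u ^ k) := by
  have hα (n : Fin M) (l : ℕ) : 0 ≤ alpha m (ρ n) x l * u ^ l :=
    mul_nonneg (alpha_nonneg (hρ n) hx l) (pow_nonneg hu l)
  have hterm (k : ℕ) : coeff m ρ x k * u ^ k = ∑ l ∈ Finset.univ.piAntidiag k,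
      ∏ n, alpha m (ρ n) x (l n) * u ^ l n := by
    rw [coeff, Finset.sum_mul]
    refine Finset.sum_congr rfl fun l hl => ?_
    rw [Finset.prod_mul_distrib, Finset.prod_pow_eq_pow_sum, (Finset.mem_piAntidiag.mp hl).1]
  rw [ennreal_prod_tsum_eq_tsum_sum_piAntidiag]
  refine tsum_congr fun k => ?_
  rw [hterm, ENNReal.ofReal_sum_of_nonneg fun l _ => Finset.prod_nonneg fun n _ => hα n _]
  exact Finset.sum_congr rfl fun l _ =>
    (ENNReal.ofReal_prod_of_nonneg fun n _ => hα n _).symm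

theorem noncentralGamma_Iic_eq_tsum_alpha (hm : 0 < m) (hr : |r| < 1) (hx : 0 ≤ x) (hu : 0 ≤ u) :
    noncentralGamma m (1 / (1 - r ^ 2)) (r ^ 2 / (1 - r ^ 2) * u) (Set.Iic x) =
      ENNReal.ofReal (Real.exp (-(r ^ 2 / (1 - r ^ 2) * u))) *
        ∑' l : ℕ, ENNReal.ofReal (alpha m r x l * u ^ l) := by
  have hr' := one_sub_sq_pos hr
  rw [noncentralGamma_Iic (by positivity) (by positivity) (by positivity) hx,
    ← ENNReal.tsum_mul_left]
  refine tsum_congr fun l => ?_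
  rw [← ENNReal.ofReal_mul (Real.exp_nonneg _), alpha, mul_pow, one_div_mul_eq_div]
  congr 1
  field_simp

theorem prod_noncentralGamma_Iic (hm : 0 < m) (hρ : ∀ n, |ρ n| < 1) (hx : 0 ≤ x) (hu : 0 ≤ u) :
    ∏ n, noncentralGamma m (1 / (1 - ρ n ^ 2)) (ρ n ^ 2 / (1 - ρ n ^ 2) * u) (Set.Iic x) =
      ENNReal.ofReal (Real.exp (-((S ρ - 1) * u))) *
        ∑' k : ℕ, ENNReal.ofReal (coeff m ρ x k * u ^ k) := by
  have hexp : -((S ρ - 1) * u) = ∑ n, -(ρ n ^ 2 / (1 - ρ n ^ 2) * u) := by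
    rw [S, add_sub_cancel_left, Finset.sum_mul, Finset.sum_neg_distrib]
  simp only [noncentralGamma_Iic_eq_tsum_alpha hm (hρ _) hx hu]
  rw [Finset.prod_mul_distrib, prod_tsum_alpha hρ hx hu, hexp, Real.exp_sum,
    ENNReal.ofReal_prod_of_nonneg fun _ _ => Real.exp_nonneg _]

theorem S_zero : S (0 : Fin M → ℝ) = 1 := by
  simp [S]

theorem coeff_zero_of_pos {k : ℕ} (hk : 0 < k) : coeff m (0 : Fin M → ℝ) x k = 0 := by
  refine Finset.sum_eq_zero fun l hl => ?_
  obtain ⟨n, -, hn⟩ : ∃ n ∈ Finset.univ, l n ≠ 0 := by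
    refine Finset.exists_ne_zero_of_sum_ne_zero ?_
    rw [(Finset.mem_piAntidiag.mp hl).1]
    exact hk.ne'
  exact Finset.prod_eq_zero (Finset.mem_univ n) (by simp [alpha, hn])

theorem coeff_zero_zero :
    coeff m (0 : Fin M → ℝ) x 0 = (1 / Real.Gamma m * lowerGamma m x) ^ M := by
  simp [coeff, alpha, div_eq_inv_mul]

end Coefficients
theorem hasLaw_curry_of_iIndepFun {Ω ι κ E : Type*} [Fintype ι] [Fintype κ] [MeasurableSpace Ω]
    [MeasurableSpace E] {P : Measure Ω} {μ : ι → κ → Measure E}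
    [∀ i j, IsProbabilityMeasure (μ i j)] {W : ι × κ → Ω → E}
    (hW : ∀ p, HasLaw (W p) (μ p.1 p.2) P) (hindep : iIndepFun W P) :
    HasLaw (fun ω i j => W (i, j) ω) (Measure.pi fun i => Measure.pi (μ i)) P := by
  have hcurry : HasLaw (MeasurableEquiv.curry ι κ E) (Measure.pi fun i => Measure.pi (μ i))
      (Measure.pi fun p : ι × κ => μ p.1 p.2) :=
    ⟨(MeasurableEquiv.measurable _).aemeasurable,
      by simpa only [Measure.infinitePi_eq_pi] using Measure.infinitePi_map_curry μ⟩
  exact hcurry.comp (hindep.hasLaw_pi hW)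

theorem pi_fin_succ_setOf_mem_forall {α : Type*} [MeasurableSpace α] {M : ℕ}
    (μ : Fin (M + 1) → Measure α) [∀ n, SigmaFinite (μ n)] {A : Set α} (hA : MeasurableSet A)
    {B : Fin M → Set (α × α)} (hB : ∀ n, MeasurableSet (B n)) :
    Measure.pi μ {z | z 0 ∈ A ∧ ∀ n, (z 0, z n.succ) ∈ B n} =
      ∫⁻ v in A, ∏ n, μ n.succ (Prod.mk v ⁻¹' B n) ∂μ 0 := by
  set C : Set (α × (Fin M → α)) := {p | p.1 ∈ A ∧ ∀ n, (p.1, p.2 n) ∈ B n}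
  have hC : MeasurableSet C := by
    simp only [C, Set.ofPred_and, Set.ofPred_forall]
    exact (measurable_fst hA).inter <| MeasurableSet.iInter fun n =>
      (measurable_fst.prodMk ((measurable_pi_apply n).comp measurable_snd)) (hB n)
  have hsection (v : α) : (Measure.pi fun n => μ n.succ) (Prod.mk v ⁻¹' C) =
      A.indicator (fun v => ∏ n, μ n.succ (Prod.mk v ⁻¹' B n)) v := by
    by_cases hv : v ∈ A
    · have hbox : Prod.mk v ⁻¹' C = Set.univ.pi fun n => Prod.mk v ⁻¹' B n := by
        ext w
        simp [C, hv]
      rw [hbox, Measure.pi_pi, Set.indicator_of_mem hv]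
    · simp [C, hv]
  have hsplit := measurePreserving_piFinSuccAbove μ 0
  have hpreim : {z : Fin (M + 1) → α | z 0 ∈ A ∧ ∀ n, (z 0, z n.succ) ∈ B n} =
      MeasurableEquiv.piFinSuccAbove (fun _ => α) 0 ⁻¹' C := rfl
  rw [hpreim, hsplit.measure_preimage hC.nullMeasurableSet, Measure.prod_apply hC,
    ← lintegral_indicator hA]
  exact lintegral_congr hsection

section Model

variable {Ω : Type*} {M m : ℕ}

/-- The real Gaussian vector behind the channel of port `n`: its real components, indexed by
`Sum.inl`, followed by its imaginary components, indexed by `Sum.inr`. -/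
def components (X Y : Fin (M + 1) → Fin m → Ω → ℝ) (ω : Ω) (n : Fin (M + 1)) :
    Fin m ⊕ Fin m → ℝ :=
  Sum.elim (fun k => X n k ω) fun k => Y n k ω

variable (ρ : Fin M → ℝ) (X Y : Fin (M + 1) → Fin m → Ω → ℝ)

theorem norm_add_I_mul_sq (a b : ℝ) : ‖(a : ℂ) + Complex.I * (b : ℂ)‖ ^ 2 = a ^ 2 + b ^ 2 := by
  rw [mul_comm, Complex.sq_norm, Complex.normSq_add_mul_I]

theorem channel_zero (ω : Ω) : channel ρ X Y 0 ω = ∑ i, components X Y ω 0 i ^ 2 := by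
  simp only [channel, gain, components, Fin.cases_zero, norm_add_I_mul_sq, Finset.sum_add_distrib,
    Fintype.sum_sum_type, Sum.elim_inl, Sum.elim_inr]

theorem channel_succ (n : Fin M) (ω : Ω) :
    channel ρ X Y n.succ ω =
      ∑ i, (√(1 - ρ n ^ 2) * components X Y ω n.succ i + ρ n * components X Y ω 0 i) ^ 2 := by
  simp only [channel, gain, components, Fin.cases_succ, norm_add_I_mul_sq, Finset.sum_add_distrib,
    Fintype.sum_sum_type, Sum.elim_inl, Sum.elim_inr]

theorem maxChannel_le_iff (ω : Ω) (x : ℝ) :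
    maxChannel ρ X Y ω ≤ x ↔ channel ρ X Y 0 ω ≤ x ∧ ∀ n : Fin M, channel ρ X Y n.succ ω ≤ x := by
  simp [maxChannel, Fin.forall_fin_succ]

variable {ρ X Y} [MeasurableSpace Ω] {P : Measure Ω}

theorem hasLaw_components {v : NNReal}
    (hX : ∀ n k, HasLaw (X n k) (gaussianReal 0 v) P)
    (hY : ∀ n k, HasLaw (Y n k) (gaussianReal 0 v) P)
    (hindep : iIndepFun (Sum.elim (fun i : Fin (M + 1) × Fin m => X i.1 i.2)
      (fun i : Fin (M + 1) × Fin m => Y i.1 i.2)) P) :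
    HasLaw (components X Y) (Measure.pi fun _ => Measure.pi fun _ => gaussianReal 0 v) P := by
  have hlaw := hasLaw_curry_of_iIndepFun (μ := fun _ _ => gaussianReal 0 v) ?_
    (hindep.precomp (Equiv.prodSumDistrib (Fin (M + 1)) (Fin m) (Fin m)).injective)
  · refine hlaw.congr (ae_of_all _ fun ω => ?_)
    ext n (k | k) <;> rfl
  · rintro ⟨n, k | k⟩
    exacts [hX n k, hY n k]

theorem aemeasurable_maxChannel (hW : AEMeasurable (components X Y) P) :
    AEMeasurable (maxChannel ρ X Y) P := by
  let F : (Fin (M + 1) → Fin m ⊕ Fin m → ℝ) → ℝ :=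
    maxChannel ρ (fun n k z => z n (Sum.inl k)) fun n k z => z n (Sum.inr k)
  have hF : Measurable F := by
    change Measurable fun z => F z
    simp only [F, maxChannel, ← Finset.sup'_apply]
    refine Finset.measurable_sup' _ fun n _ => ?_
    unfold channel
    cases n using Fin.cases <;> simp only [gain, Fin.cases_zero, Fin.cases_succ] <;> fun_prop
  have hcomp : maxChannel ρ X Y = F ∘ components X Y := rfl
  exact hcomp ▸ hF.comp_aemeasurable hW

theorem pi_gaussianReal_sum_sq_le (hm : 0 < m) {r : ℝ} (hr : |r| < 1) (v : Fin m ⊕ Fin m → ℝ)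
    (x : ℝ) :
    (Measure.pi fun _ : Fin m ⊕ Fin m => gaussianReal 0 (1 / 2))
        {w | ∑ i, (√(1 - r ^ 2) * w i + r * v i) ^ 2 ≤ x} =
      noncentralGamma m (1 / (1 - r ^ 2)) (r ^ 2 / (1 - r ^ 2) * ∑ i, v i ^ 2) (Set.Iic x) := by
  have : NeZero m := ⟨hm.ne'⟩
  have hr' := one_sub_sq_pos hr
  have hlaw := map_sum_sq_affine_pi_gaussianReal (v := 1 / 2) (Real.sqrt_ne_zero'.mpr hr')
    (fun i => r * v i) (by norm_num)
  have hshape : (Fintype.card (Fin m ⊕ Fin m) / 2 : ℝ) = m := by simp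
  have hscale : 2 * (√(1 - r ^ 2) ^ 2 * ((1 / 2 : NNReal) : ℝ)) = 1 - r ^ 2 := by
    rw [Real.sq_sqrt hr'.le, NNReal.coe_div, NNReal.coe_one, NNReal.coe_ofNat]
    ring
  simp only [hshape, hscale, mul_pow, ← Finset.mul_sum] at hlaw
  rw [div_mul_eq_mul_div, ← hlaw, Measure.map_apply (by fun_prop) measurableSet_Iic]
  rfl

theorem map_sum_sq_pi_gaussianReal_half (hm : 0 < m) :
    (Measure.pi fun _ : Fin m ⊕ Fin m => gaussianReal 0 (1 / 2)).map (fun v => ∑ i, v i ^ 2) =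
      gammaMeasure m 1 := by
  have : NeZero m := ⟨hm.ne'⟩
  have hlaw := map_sum_sq_pi_gaussianReal (fun _ : Fin m ⊕ Fin m => 0) (v := 1 / 2) (by norm_num)
  simpa [noncentralGamma_zero] using hlaw

theorem measure_maxChannel_le_eq_setLIntegral
    {μ : Measure (Fin m ⊕ Fin m → ℝ)} [SigmaFinite μ]
    (hW : HasLaw (components X Y) (Measure.pi fun _ => μ) P) (x : ℝ) :
    P {ω | maxChannel ρ X Y ω ≤ x} = ∫⁻ v in {v | ∑ i, v i ^ 2 ≤ x},
      ∏ n, μ {w | ∑ i, (√(1 - ρ n ^ 2) * w i + ρ n * v i) ^ 2 ≤ x} ∂μ := by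
  let A : Set (Fin m ⊕ Fin m → ℝ) := {v | ∑ i, v i ^ 2 ≤ x}
  let B (n : Fin M) : Set ((Fin m ⊕ Fin m → ℝ) × (Fin m ⊕ Fin m → ℝ)) :=
    {p | ∑ i, (√(1 - ρ n ^ 2) * p.2 i + ρ n * p.1 i) ^ 2 ≤ x}
  have hA : MeasurableSet A := measurableSet_le (by fun_prop) measurable_const
  have hB (n : Fin M) : MeasurableSet (B n) := measurableSet_le (by fun_prop) measurable_const
  have hAB : MeasurableSet {z : Fin (M + 1) → Fin m ⊕ Fin m → ℝ |
      z 0 ∈ A ∧ ∀ n, (z 0, z n.succ) ∈ B n} := by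
    simp only [Set.ofPred_and, Set.ofPred_forall]
    exact (measurable_pi_apply 0 hA).inter <| MeasurableSet.iInter fun n =>
      ((measurable_pi_apply 0).prodMk (measurable_pi_apply n.succ)) (hB n)
  calc P {ω | maxChannel ρ X Y ω ≤ x}
      = Measure.pi (fun _ => μ) {z | z 0 ∈ A ∧ ∀ n, (z 0, z n.succ) ∈ B n} := by
        rw [← hW.measure_eq hAB]
        simp only [A, B, maxChannel_le_iff, channel_zero, channel_succ, Set.mem_ofPred_eq]
    _ = _ := pi_fin_succ_setOf_mem_forall _ hA hB

theorem measure_maxChannel_le (hm : 0 < m) (hρ : ∀ n, |ρ n| < 1)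
    (hW : HasLaw (components X Y)
      (Measure.pi fun _ => Measure.pi fun _ => gaussianReal 0 (1 / 2)) P) {x : ℝ} (hx : 0 ≤ x) :
    P {ω | maxChannel ρ X Y ω ≤ x} = ∑' k : ℕ, ENNReal.ofReal (1 / Real.Gamma m *
        (coeff m ρ x k / S ρ ^ (m + k) * lowerGamma (m + k) (S ρ * x))) := by
  have hS : 1 + (S ρ - 1) = S ρ := add_sub_cancel _ _
  calc P {ω | maxChannel ρ X Y ω ≤ x}
      = ∫⁻ v in {v : Fin m ⊕ Fin m → ℝ | ∑ i, v i ^ 2 ≤ x},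
          ENNReal.ofReal (Real.exp (-((S ρ - 1) * ∑ i, v i ^ 2))) *
            ∑' k : ℕ, ENNReal.ofReal (coeff m ρ x k * (∑ i, v i ^ 2) ^ k)
          ∂Measure.pi fun _ => gaussianReal 0 (1 / 2) := by
        rw [measure_maxChannel_le_eq_setLIntegral hW]
        refine lintegral_congr fun v => ?_
        rw [← prod_noncentralGamma_Iic hm hρ hx (by positivity)]
        exact Finset.prod_congr rfl fun n _ => pi_gaussianReal_sum_sq_le hm (hρ n) v x
    _ = ∫⁻ u in Set.Iic x, ENNReal.ofReal (Real.exp (-((S ρ - 1) * u))) *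
          ∑' k : ℕ, ENNReal.ofReal (coeff m ρ x k * u ^ k) ∂gammaMeasure m 1 := by
        rw [← map_sum_sq_pi_gaussianReal_half hm,
          setLIntegral_map measurableSet_Iic (by fun_prop) (by fun_prop)]
        rfl
    _ = _ := by
        rw [setLIntegral_Iic_exp_mul_tsum_gammaMeasure (by positivity) one_pos
          (by rw [hS]; exact S_pos hρ) hx (coeff_nonneg hρ hx), hS]
        simp only [← Nat.cast_add, Real.rpow_natCast, one_pow]

theorem hasSum_cdf_maxChannel [IsProbabilityMeasure P] (hm : 0 < m) (hρ : ∀ n, |ρ n| < 1)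
    (hW : HasLaw (components X Y)
      (Measure.pi fun _ => Measure.pi fun _ => gaussianReal 0 (1 / 2)) P) {x : ℝ} (hx : 0 ≤ x) :
    HasSum (fun k : ℕ => 1 / Real.Gamma m *
        (coeff m ρ x k / S ρ ^ (m + k) * lowerGamma (m + k) (S ρ * x)))
      (cdf (P.map (maxChannel ρ X Y)) x) := by
  have hmeas := aemeasurable_maxChannel (ρ := ρ) hW.aemeasurable
  have := Measure.isProbabilityMeasure_map hmeas
  have hS := S_pos hρ
  have hnonneg (k : ℕ) : 0 ≤ 1 / Real.Gamma m *
      (coeff m ρ x k / S ρ ^ (m + k) * lowerGamma (m + k) (S ρ * x)) := by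
    have hc := coeff_nonneg (m := m) hρ hx k
    have hγ := lowerGamma_nonneg (m + k) (mul_nonneg hS.le hx)
    positivity
  have hlaw : P.map (maxChannel ρ X Y) (Set.Iic x) = _ :=
    (Measure.map_apply_of_aemeasurable hmeas measurableSet_Iic).trans
      (measure_maxChannel_le hm hρ hW hx)
  rw [cdf_eq_real, measureReal_def, hlaw, ENNReal.tsum_toReal_eq fun _ => ENNReal.ofReal_ne_top]
  have hsum := ENNReal.hasSum_toReal (hlaw ▸ measure_ne_top _ _)
  simpa only [ENNReal.toReal_ofReal (hnonneg _)] using hsum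

end Model

end FluidAntenna

theorem proposition1 {Ω : Type*} [MeasurableSpace Ω] (P : Measure Ω) [IsProbabilityMeasure P]
    (M m : ℕ) (hm : 1 ≤ m)
    (ρ : Fin M → ℝ) (hρ : ∀ n, |ρ n| < 1)
    (X Y : Fin (M + 1) → Fin m → Ω → ℝ)
    (hX : ∀ n k, HasLaw (X n k) (gaussianReal 0 (1 / 2)) P)
    (hY : ∀ n k, HasLaw (Y n k) (gaussianReal 0 (1 / 2)) P)
    (hindep : iIndepFun
      (Sum.elim (fun i : Fin (M + 1) × Fin m => X i.1 i.2)
        (fun i : Fin (M + 1) × Fin m => Y i.1 i.2)) P)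
    (x : ℝ) (hx : 0 ≤ x) :
    (Summable (fun k : ℕ =>
        FluidAntenna.coeff m ρ x k / FluidAntenna.S ρ ^ (m + k) *
          FluidAntenna.lowerGamma (m + k) (FluidAntenna.S ρ * x)) ∧
      cdf (P.map (FluidAntenna.maxChannel ρ X Y)) x =
        1 / Real.Gamma m * ∑' k : ℕ,
          FluidAntenna.coeff m ρ x k / FluidAntenna.S ρ ^ (m + k) *
            FluidAntenna.lowerGamma (m + k) (FluidAntenna.S ρ * x)) ∧
    ((∀ n, ρ n = 0) →
      FluidAntenna.S ρ = 1 ∧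
      (∀ k : ℕ, 0 < k → FluidAntenna.coeff m ρ x k = 0) ∧
      cdf (P.map (FluidAntenna.maxChannel ρ X Y)) x =
        (1 / Real.Gamma m * FluidAntenna.lowerGamma m x) ^ (M + 1)) := by
  have hsum := FluidAntenna.hasSum_cdf_maxChannel hm hρ
    (FluidAntenna.hasLaw_components hX hY hindep) hx
  have hΓ : 1 / Real.Gamma m ≠ 0 :=
    one_div_ne_zero (Real.Gamma_pos_of_pos (by positivity)).ne'
  have hcdf := hsum.tsum_eq.symm
  rw [tsum_mul_left] at hcdf
  refine ⟨⟨(summable_mul_left_iff hΓ).mp hsum.summable, hcdf⟩, fun h => ?_⟩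
  obtain rfl : ρ = 0 := funext h
  refine ⟨FluidAntenna.S_zero, fun k hk => FluidAntenna.coeff_zero_of_pos hk, ?_⟩
  have hvanish (k : ℕ) (hk : k ≠ 0) := FluidAntenna.coeff_zero_of_pos (m := m) (x := x) (M := M)
    (Nat.pos_of_ne_zero hk)
  rw [hcdf, tsum_eq_single 0 fun k hk => by rw [hvanish k hk, zero_div, zero_mul],
    FluidAntenna.coeff_zero_zero, FluidAntenna.S_zero]
  simp only [one_pow, div_one, Nat.cast_zero, add_zero, one_mul]
  ring
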